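/- Let $R$ be an integral domain that is a $\mathbb{C}$-algebra, let $n\ge 1$ and $0\le k\le n$ be integers, let $a,b\in R$, and let $q\in R$ be invertible with an $n$-th root in $R$ (for instance $R=\mathbb{C}[q^{\pm 1/n}][a,b]$ with $q^{1/n},a,b$ indeterminates). Let $x$ be a formal variable. Let $V=\mathbb{C}v_0\oplus\mathbb{C}v_1$. For a vertex whose west, north, east and south edges have values $W,N,E,S\in\{0,1\}$ define the free-fermion Boltzmann weights $$\Omega(0,0,0,0)=1,\quad \Omega(1,1,1,1)=ax,\quad \Omega(0,1,0,1)=1,\quad \Omega(1,0,1,0)=bx,\quad \Omega(1,0,0,1)=1,\quad \Omega(0,1,1,0)=(a+b)x,$$ and $\Omega(W,N,E,S)=0$ for all other values. The transfer matrix with quasi-periodic boundary conditions $\tau(x;a,b)=A+qD$ is the operator on $R[x]\otimes V^{\otimes n}$ given by $$\tau(x;a,b)\,v_{\sigma_1}\otimes\cdots\otimes v_{\sigma_n}=\sum_{\sigma'\in\{0,1\}^n}\ \sum_{\substack{h_0,\dots,h_n\in\{0,1\}\\ h_0=h_n}}q^{h_0}\prod_{j=1}^n\Omega(h_{j-1},\sigma_j,h_j,\sigma'_j)\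 v_{\sigma'_1}\otimes\cdots\otimes v_{\sigma'_n}.$$ It preserves $R[x]\otimes V_k$, where $V_k\subset V^{\otimes n}$ is the span of the vectors $v_{\sigma_1}\otimes\cdots\otimes v_{\sigma_n}$ with exactly $k$ of the $\sigma_i$ equal to $1$. **Proposition.** The set $\Xi$ of all $k$-element sets $\{\xi_1,\dots,\xi_k\}\subset R$ of distinct solutions of the Bethe ansatz equations $$\xi_i^n+(-1)^kq=0,\qquad i=1,\dots,k,$$ has $\binom nk=\dim V_k$ elements. The restriction of $\tau(x;a,b)$ to $V_k$ is diagonalisable: the free $R$-module $R\otimes V_k$ has a basis $(v_\xi)_{\xi\in\Xi}$, not involving $x$, with $$\tau(x;a,b)\,v_\xi=(1+(-1)^kq\,x^nb^n)\prod_{i=1}^k\frac{1+ax\xi_i}{1-bx\xi_i}\;v_\xi\qquad\text{for all }\xi\in\Xi .$$ The Bethe ansatz is complete: an element of the field of fractions of $R[x]$ is an eigenvalue of the restriction of $\tau(x;a,b)$ to $V_k$ if and only if it is one of these rational functions for some $\xi\in\Xi$. -/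

import Mathlib

open Polynomial

noncomputable section

namespace SixVertex

/-- The six Boltzmann weights `ω₁, …, ω₆` of the asymmetric six-vertex model. -/
structure Weights (S : Type*) where
  w1 : S
  w2 : S
  w3 : S
  w4 : S
  w5 : S
  w6 : S

/-- The weight `Ω(W, N, E, S)` of a single vertex, as a function of the values (`false` for `0`,
`true` for `1`) of its west, north, east and south edges. All other configurations are
forbidden. -/
def vertexWeight {S : Type*} [Zero S] (ω : Weights S) : Bool → Bool → Bool → Bool → S
  | false, false, false, false => ω.w1
  | true, true, true, true => ω.w2
  | false, true, false, true => ω.w3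
  | true, false, true, false => ω.w4
  | true, false, false, true => ω.w5
  | false, true, true, false => ω.w6
  | _, _, _, _ => 0

/-- The row-to-row transfer matrix of a row with `n` vertices whose outer left horizontal edge has
value `α` and whose outer right one has value `β`. The row index is the binary string of the
vertical edges on the bottom, the column index the one of those on top; the entry is the sum over
all values `h 0, …, h n` of the horizontal edges (from left to right) compatible with `α`, `β`.
The operators `A` and `D` of the Yang-Baxter algebra are `rowTransfer n ω false false` and
`rowTransfer n ω true true`. -/
def rowTransfer {S : Type*} [CommRing S] (n : ℕ) (ω : Weights S) (α β : Bool) :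
    Matrix (Fin n → Bool) (Fin n → Bool) S :=
  Matrix.of fun bottom top =>
    ∑ h : Fin (n + 1) → Bool,
      if h 0 = α ∧ h (Fin.last n) = β then
        ∏ j : Fin n, vertexWeight ω (h j.castSucc) (top j) (h j.succ) (bottom j)
      else 0

/-- The transfer matrix with quasi-periodic boundary conditions `τ = A + q D`, with respect to the
standard basis of `V^{⊗ n}`, whose elements are labelled by binary strings of length `n`. -/
def transferMatrix {S : Type*} [CommRing S] (n : ℕ) (ω : Weights S) (q : S) :
    Matrix (Fin n → Bool) (Fin n → Bool) S :=
  rowTransfer n ω false false + q • rowTransfer n ω true true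

/-- The free-fermion weights with parameters `a`, `b` and spectral parameter `x`. -/
def freeFermion {S : Type*} [CommRing S] (a b x : S) : Weights S where
  w1 := 1
  w2 := a * x
  w3 := 1
  w4 := b * x
  w5 := 1
  w6 := (a + b) * x

/-- The number of `1`-letters of a binary string. -/
def numOnes {n : ℕ} (σ : Fin n → Bool) : ℕ := ∑ i, (σ i).toNat

/-- The subspace `V_k` of `V^{⊗ n}` (with scalars in `S`): the vectors supported on the basis
vectors `v_σ` where `σ` has exactly `k` letters `1`. -/
def sector (S : Type*) [CommRing S] (n k : ℕ) : Submodule S ((Fin n → Bool) → S) where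
  carrier := {f | ∀ σ, numOnes σ ≠ k → f σ = 0}
  add_mem' := by
    intro f g hf hg σ hσ
    simp [hf σ hσ, hg σ hσ]
  zero_mem' := by
    intro σ _
    rfl
  smul_mem' := by
    intro c f hf σ hσ
    simp [hf σ hσ]

theorem vertexWeight_eq_zero {S : Type*} [CommRing S] (ω : Weights S) (W N E So : Bool)
    (h : W.toNat + N.toNat ≠ E.toNat + So.toNat) : vertexWeight ω W N E So = 0 := by
  cases W <;> cases N <;> cases E <;> cases So <;> simp_all [vertexWeight]

theorem rowTransfer_eq_zero {S : Type*} [CommRing S] (n : ℕ) (ω : Weights S) (α : Bool)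
    (bottom top : Fin n → Bool) (hne : numOnes bottom ≠ numOnes top) :
    rowTransfer n ω α α bottom top = 0 := by
  unfold rowTransfer
  rw [Matrix.of_apply]
  refine Finset.sum_eq_zero fun h _ => ?_
  split_ifs with hb
  · by_contra hprod
    apply hne
    have hice : ∀ j : Fin n, (h j.castSucc).toNat + (top j).toNat
        = (h j.succ).toNat + (bottom j).toNat := by
      intro j
      by_contra hj
      exact hprod (Finset.prod_eq_zero (Finset.mem_univ j) (vertexWeight_eq_zero ω _ _ _ _ hj))
    have hsum : (∑ j : Fin n, (h j.castSucc).toNat) + numOnes top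
        = (∑ j : Fin n, (h j.succ).toNat) + numOnes bottom := by
      simp only [numOnes, ← Finset.sum_add_distrib]
      exact Finset.sum_congr rfl fun j _ => hice j
    have h1 := Fin.sum_univ_succ (fun i : Fin (n + 1) => (h i).toNat)
    have h2 := Fin.sum_univ_castSucc (fun i : Fin (n + 1) => (h i).toNat)
    rw [hb.1] at h1
    rw [hb.2] at h2
    omega
  · rfl

/-- The transfer matrix conserves the number of `1`-letters. -/
theorem transferMatrix_mem_sector {S : Type*} [CommRing S] (n k : ℕ) (ω : Weights S) (q : S) :
    ∀ f ∈ sector S n k, (transferMatrix n ω q).mulVecLin f ∈ sector S n k := by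
  intro f hf σ hσ
  rw [Matrix.mulVecLin_apply]
  refine Finset.sum_eq_zero fun ρ _ => ?_
  by_cases hρ : numOnes ρ = k
  · have hne : numOnes σ ≠ numOnes ρ := by rw [hρ]; exact hσ
    simp [transferMatrix, rowTransfer_eq_zero n ω _ σ ρ hne]
  · simp [hf ρ hρ]

/-- The restriction of the quasi-periodic transfer matrix at the free-fermion weights,
`τ(x; a, b)`, to `V_k`. -/
def sectorTransfer {S : Type*} [CommRing S] (n k : ℕ) (q a b x : S) :
    Module.End S (sector S n k) :=
  (transferMatrix n (freeFermion a b x) q).mulVecLin.restrict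
    (transferMatrix_mem_sector n k (freeFermion a b x) q)

/-- Extension of scalars `V_k → L ⊗ V_k` for an `R`-algebra `L`. -/
def sectorMap {R : Type*} [CommRing R] (L : Type*) [CommRing L] [Algebra R L] {n k : ℕ}
    (v : sector R n k) : sector L n k :=
  ⟨fun σ => algebraMap R L ((v : (Fin n → Bool) → R) σ), fun σ hσ => by
    simp [v.2 σ hσ]⟩

/-- The solutions of the Bethe ansatz equations: sets `{ξ₁, …, ξ_k}` of `k` distinct solutions of
`ξ ^ n + (-1) ^ k * q = 0`. -/
abbrev BetheSolution (R : Type*) [CommRing R] (n k : ℕ) (q : R) : Type _ :=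
  {s : Finset R // s.card = k ∧ ∀ ξ ∈ s, ξ ^ n + (-1) ^ k * q = 0}

/-- The field of fractions of `R[x]`, where `x` is a formal variable. -/
abbrev SpectralField (R : Type*) [CommRing R] : Type _ := FractionRing R[X]

/-- The spectral parameter `x`, as an element of the field of fractions of `R[x]`. -/
def spectralX (R : Type*) [CommRing R] : SpectralField R :=
  algebraMap R[X] (SpectralField R) X

/-- The rational function
`(1 + (-1) ^ k q x ^ n b ^ n) ∏ ξ ∈ s, (1 + a x ξ) / (1 - b x ξ)` of the formal variable `x`. -/
def betheEigenvalue {R : Type*} [CommRing R] [IsDomain R] (n k : ℕ) (q a b : R)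
    (s : Finset R) : SpectralField R :=
  let ι := algebraMap R (SpectralField R)
  let x := spectralX R
  (1 + (-1) ^ k * ι q * x ^ n * ι b ^ n) * ∏ ξ ∈ s, (1 + ι a * x * ι ξ) / (1 - ι b * x * ι ξ)

end SixVertex

end

/-!
The exchange relations of the free-fermion weights show that a row of vertices almost commutes
with the fermionic operator that creates a particle in a plane wave with multiplier `ξ`; the
failure is located at the two ends of the row. On `V_k` these boundary terms cancel if
`ξ ^ n = (-1) ^ k * q`, and then the creation operator intertwines the transfer matrices with
twists `q` and `-q` up to the factor `(1 + a x ξ) / (1 - b x ξ)`. Each particle thus changes the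
sign of the twist, so that a state of `k` plane waves, created from the vacuum, is an eigenvector
as soon as all its `ξ` satisfy the same equation `ξ ^ n + (-1) ^ k * q = 0`. The `n` plane waves
with these `ξ` form a basis of the one-particle space by Fourier inversion, and the Jordan–Wigner
transform identifies `V_k` with the `k`-th exterior power of that space; so the Bethe vectors form
a basis of `V_k`.
-/

noncomputable section

namespace SixVertex

open Matrix

section Block

variable {S : Type*} {n : ℕ}

/-- The block with row label `s` and column label `t` of an operator on `V^{⊗ (n + 1)}`, with
respect to the decomposition `V ⊗ V^{⊗ n}` that splits off the leftmost site. -/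
def block (s t : Bool) (M : Matrix (Fin (n + 1) → Bool) (Fin (n + 1) → Bool) S) :
    Matrix (Fin n → Bool) (Fin n → Bool) S :=
  M.submatrix (fun σ => Fin.cons s σ) fun τ => Fin.cons t τ

theorem ext_block {M N : Matrix (Fin (n + 1) → Bool) (Fin (n + 1) → Bool) S}
    (h : ∀ s t, block s t M = block s t N) : M = N := by
  ext σ τ
  rw [← Fin.cons_self_tail σ, ← Fin.cons_self_tail τ]
  exact congrFun₂ (h (σ 0) (τ 0)) (Fin.tail σ) (Fin.tail τ)

variable [CommRing S]

theorem block_add (s t : Bool) (M N : Matrix (Fin (n + 1) → Bool) (Fin (n + 1) → Bool) S) :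
    block s t (M + N) = block s t M + block s t N := rfl

theorem block_sub (s t : Bool) (M N : Matrix (Fin (n + 1) → Bool) (Fin (n + 1) → Bool) S) :
    block s t (M - N) = block s t M - block s t N := rfl

theorem block_zero (s t : Bool) :
    block s t (0 : Matrix (Fin (n + 1) → Bool) (Fin (n + 1) → Bool) S) = 0 := rfl

theorem block_smul (s t : Bool) (c : S)
    (M : Matrix (Fin (n + 1) → Bool) (Fin (n + 1) → Bool) S) :
    block s t (c • M) = c • block s t M := rfl

theorem block_sum {ι : Type*} (Z : Finset ι)
    (M : ι → Matrix (Fin (n + 1) → Bool) (Fin (n + 1) → Bool) S) (s t : Bool) :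
    block s t (∑ i ∈ Z, M i) = ∑ i ∈ Z, block s t (M i) := by
  ext σ τ
  simp [block, Matrix.sum_apply]

theorem block_mul (s t : Bool) (M N : Matrix (Fin (n + 1) → Bool) (Fin (n + 1) → Bool) S) :
    block s t (M * N) = block s false M * block false t N + block s true M * block true t N := by
  ext σ τ
  simp only [block, submatrix_apply, mul_apply, Matrix.add_apply]
  rw [← (Fin.consEquiv fun _ : Fin (n + 1) => Bool).sum_comp, Fintype.sum_prod_type,
    Fintype.sum_bool, add_comm]
  rfl

end Block

section RowTransfer

variable {S : Type*} [CommRing S] {n : ℕ}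

theorem rowTransfer_zero (ω : Weights S) (α β : Bool) :
    rowTransfer 0 ω α β = if α = β then 1 else 0 := by
  ext σ τ
  have hends (h : Fin 1 → Bool) : h (Fin.last 0) = h 0 := rfl
  simp only [rowTransfer, of_apply, hends, Finset.univ_eq_empty, Finset.prod_empty]
  rw [← (Equiv.funUnique (Fin 1) Bool).symm.sum_comp, Subsingleton.elim σ τ]
  cases α <;> cases β <;> simp

theorem block_rowTransfer (ω : Weights S) (α β s t : Bool) :
    block s t (rowTransfer (n + 1) ω α β) =
      vertexWeight ω α t false s • rowTransfer n ω false β +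
        vertexWeight ω α t true s • rowTransfer n ω true β := by
  ext σ τ
  simp only [block, rowTransfer, submatrix_apply, Matrix.add_apply, Matrix.smul_apply, of_apply,
    smul_eq_mul, Finset.mul_sum]
  rw [← Finset.sum_add_distrib, ← (Fin.consEquiv fun _ : Fin (n + 2) => Bool).sum_comp,
    Fintype.sum_prod_type, Finset.sum_comm]
  refine Finset.sum_congr rfl fun h _ => ?_
  rw [Fintype.sum_eq_single α fun γ hγ => by simp [hγ]]
  have hlast : (Fin.cons α h : Fin (n + 2) → Bool) (Fin.last (n + 1)) = h (Fin.last n) := by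
    rw [← Fin.succ_last, Fin.cons_succ]
  cases h0 : h 0 <;> simp [Fin.prod_univ_succ, hlast, h0]

end RowTransfer

section Creation

variable {S : Type*} [CommRing S] {n : ℕ}

/-- The number of letters `1` to the left of site `j`, which governs the Jordan–Wigner sign. -/
def onesBefore (σ : Fin n → Bool) (j : Fin n) : ℕ := ∑ i with i < j, (σ i).toNat

/-- The fermion parity operator, with value `(-1) ^ k` on `V_k`. -/
def fermionParity (S : Type*) [CommRing S] (n : ℕ) : Matrix (Fin n → Bool) (Fin n → Bool) S :=
  diagonal fun σ => (-1) ^ numOnes σ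

/-- The fermionic operator that creates a letter `1` at site `j`, with its Jordan–Wigner sign. -/
def creator (S : Type*) [CommRing S] (j : Fin n) : Matrix (Fin n → Bool) (Fin n → Bool) S :=
  of fun σ τ => if τ j = false ∧ σ = Function.update τ j true then (-1) ^ onesBefore τ j else 0

/-- The fermionic operator that creates a letter `1` in the one-particle state `u`. -/
def creation : (Fin n → S) →ₗ[S] Matrix (Fin n → Bool) (Fin n → Bool) S :=
  Fintype.linearCombination S (creator S)

theorem creation_eq_sum (u : Fin n → S) : creation u = ∑ j, u j • creator S j :=
  Fintype.linearCombination_apply ..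

theorem onesBefore_zero (σ : Fin (n + 1) → Bool) : onesBefore σ 0 = 0 := by
  simp [onesBefore]

theorem onesBefore_cons_succ (s : Bool) (σ : Fin n → Bool) (j : Fin n) :
    onesBefore (Fin.cons s σ : Fin (n + 1) → Bool) j.succ = s.toNat + onesBefore σ j := by
  simp [onesBefore, Finset.sum_filter, Fin.sum_univ_succ]

theorem numOnes_cons (s : Bool) (σ : Fin n → Bool) :
    numOnes (Fin.cons s σ : Fin (n + 1) → Bool) = s.toNat + numOnes σ := by
  simp [numOnes, Fin.sum_univ_succ]

theorem block_fermionParity (s t : Bool) :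
    block s t (fermionParity S (n + 1)) =
      if s = t then (-1 : S) ^ t.toNat • fermionParity S n else 0 := by
  ext σ τ
  by_cases hst : s = t
  · simp [block, fermionParity, diagonal_apply, numOnes_cons, pow_add, hst]
  · simp [block, fermionParity, hst]

theorem block_creator_zero (s t : Bool) :
    block s t (creator S (0 : Fin (n + 1))) = if s = true ∧ t = false then 1 else 0 := by
  ext σ τ
  cases s <;> cases t <;>
    simp [block, creator, onesBefore_zero, Matrix.one_apply]

theorem block_creator_succ (s t : Bool) (j : Fin n) :
    block s t (creator S j.succ) = if s = t then (-1 : S) ^ t.toNat • creator S j else 0 := by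
  ext σ τ
  by_cases hst : s = t
  · simp [block, creator, onesBefore_cons_succ, ← Fin.cons_update, pow_add, hst]
  · simp [block, creator, ← Fin.cons_update, hst]

theorem block_creation (u : Fin (n + 1) → S) (s t : Bool) :
    block s t (creation u) =
      (if s = true ∧ t = false then u 0 • 1 else 0) +
        if s = t then (-1 : S) ^ t.toNat • creation (Fin.tail u) else 0 := by
  rw [creation_eq_sum, creation_eq_sum, Fin.sum_univ_succ, block_add, block_sum]
  simp only [block_smul, block_creator_zero, block_creator_succ, Fin.tail]
  split_ifs <;> simp only [smul_zero, Finset.sum_const_zero, Finset.smul_sum, smul_comm (u _)]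

theorem block_mul_creation (M : Matrix (Fin (n + 1) → Bool) (Fin (n + 1) → Bool) S)
    (u : Fin (n + 1) → S) (s t : Bool) :
    block s t (M * creation u) =
      ((!t).toNat * u 0) • block s true M +
        (-1 : S) ^ t.toNat • (block s t M * creation (Fin.tail u)) := by
  cases t <;> simp [block_mul, block_creation, add_comm]

theorem block_creation_mul (M : Matrix (Fin (n + 1) → Bool) (Fin (n + 1) → Bool) S)
    (u : Fin (n + 1) → S) (s t : Bool) :
    block s t (creation u * M) =
      (s.toNat * u 0) • block false t M +
        (-1 : S) ^ s.toNat • (creation (Fin.tail u) * block s t M) := by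
  cases s <;> simp [block_mul, block_creation]

theorem block_mul_fermionParity (M : Matrix (Fin (n + 1) → Bool) (Fin (n + 1) → Bool) S)
    (s t : Bool) :
    block s t (M * fermionParity S (n + 1)) =
      (-1 : S) ^ t.toNat • (block s t M * fermionParity S n) := by
  cases t <;> simp [block_mul, block_fermionParity]

theorem creation_mul_self (u : Fin n → S) : creation u * creation u = 0 := by
  induction n with
  | zero => simp [creation_eq_sum]
  | succ n ih =>
    refine ext_block fun s t => ?_
    rw [block_mul, block_zero]
    cases s <;> cases t <;> simp [block_creation, ih]

end Creation

section Exchange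

variable {S : Type*} [CommRing S] {n : ℕ}

/-- The free-fermion condition `w1 * w2 + w3 * w4 = w5 * w6` enters here. -/
theorem vertexWeight_exchange (a b x ξ : S) (α s t γ : Bool) :
    (1 - b * x * ξ) * ((!t).toNat * vertexWeight (freeFermion a b x) α true γ s) -
        (1 + a * x * ξ) * ((-1) ^ α.toNat *
          (s.toNat * vertexWeight (freeFermion a b x) α t γ false)) =
      (a + b) * x * ((-1) ^ t.toNat *
          (γ.toNat * vertexWeight (freeFermion a b x) α t false s) -
        (!α).toNat * ξ * vertexWeight (freeFermion a b x) true t γ s) := by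
  cases α <;> cases s <;> cases t <;> cases γ <;> simp [vertexWeight, freeFermion] <;> ring

theorem vertexWeight_sign (ω : Weights S) (W N E So : Bool) :
    (-1) ^ W.toNat * (-1) ^ So.toNat * vertexWeight ω W N E So =
      (-1) ^ N.toNat * (-1) ^ E.toNat * vertexWeight ω W N E So := by
  cases W <;> cases N <;> cases E <;> cases So <;> simp [vertexWeight]

theorem rowTransfer_mul_creation (a b x ξ : S) (w : Fin (n + 1) → S)
    (hw : ∀ j : Fin n, w j.castSucc = ξ * w j.succ) (α β : Bool) :
    (1 - b * x * ξ) • (rowTransfer n (freeFermion a b x) α β * creation (Fin.tail w)) =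
      ((1 + a * x * ξ) * (-1) ^ α.toNat) •
          (creation (Fin.tail w) * rowTransfer n (freeFermion a b x) α β) +
        ((a + b) * x) •
          ((β.toNat * w (Fin.last n)) •
              (rowTransfer n (freeFermion a b x) α false * fermionParity S n) -
            ((!α).toNat * w 0) • rowTransfer n (freeFermion a b x) true β) := by
  induction n generalizing α with
  | zero =>
    have hP : fermionParity S 0 = 1 := by simp [fermionParity, numOnes]
    cases α <;> cases β <;> simp [rowTransfer_zero, creation_eq_sum, hP, Fin.last]
  | succ n ih =>
    have hw0 : w 0 = ξ * Fin.tail w 0 := hw 0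
    have hlast : Fin.tail w (Fin.last n) = w (Fin.last (n + 1)) := rfl
    have ih := ih (Fin.tail w) fun j => hw j.succ
    refine ext_block fun s t => ?_
    have exchange := vertexWeight_exchange a b x ξ α s t
    have sign γ := vertexWeight_sign (freeFermion a b x) α t γ s
    simp only [block_smul, block_add, block_sub, block_mul_creation, block_creation_mul,
      block_mul_fermionParity, block_rowTransfer, add_mul _ _ (creation _),
      add_mul _ _ (fermionParity _ _), mul_add (creation _), smul_mul, Matrix.mul_smul, hw0]
    simp only [hlast, Bool.forall_bool, Bool.toNat_false, Bool.toNat_true, Bool.not_true,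
      Bool.not_false, Nat.cast_one, Nat.cast_zero, pow_zero, pow_one] at ih exchange sign
    linear_combination (norm := module)
      ((-1) ^ t.toNat * vertexWeight (freeFermion a b x) α t false s) • ih.1 +
      ((-1) ^ t.toNat * vertexWeight (freeFermion a b x) α t true s) • ih.2 +
      (Fin.tail w 0 * exchange.1) • rowTransfer n (freeFermion a b x) false β +
      (Fin.tail w 0 * exchange.2) • rowTransfer n (freeFermion a b x) true β -
      ((1 + a * x * ξ) * sign.1) •
        (creation (Fin.tail (Fin.tail w)) * rowTransfer n (freeFermion a b x) false β) -
      ((1 + a * x * ξ) * sign.2) •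
        (creation (Fin.tail (Fin.tail w)) * rowTransfer n (freeFermion a b x) true β)

end Exchange

section Boundary

variable {S : Type*} [CommRing S] {n k : ℕ}

/-- The one-particle state `∑ j, ξ ^ (n - 1 - j) e_j`, where `j = 0, …, n - 1`: a plane wave,
normalised so that `ξ` need not be invertible. -/
def planeWave (n : ℕ) (ξ : S) (j : Fin n) : S := ξ ^ (j.rev : ℕ)

theorem planeWave_zero (n : ℕ) (ξ : S) : planeWave (n + 1) ξ 0 = ξ ^ n := by
  simp [planeWave]

theorem planeWave_last (n : ℕ) (ξ : S) : planeWave (n + 1) ξ (Fin.last n) = 1 := by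
  simp [planeWave]

theorem tail_planeWave (n : ℕ) (ξ : S) : Fin.tail (planeWave (n + 1) ξ) = planeWave n ξ := by
  ext j
  simp [planeWave, Fin.tail, Fin.rev_succ]

theorem planeWave_castSucc (ξ : S) (j : Fin n) :
    planeWave (n + 1) ξ j.castSucc = ξ * planeWave (n + 1) ξ j.succ := by
  simp [planeWave, Fin.rev_castSucc, Fin.rev_succ, pow_succ']

theorem transferMatrix_mul_creation_planeWave (q a b x ξ : S) :
    (1 - b * x * ξ) •
        (transferMatrix n (freeFermion a b x) q * creation (planeWave n ξ)) =
      (1 + a * x * ξ) •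
          (creation (planeWave n ξ) * transferMatrix n (freeFermion a b x) (-q)) +
        ((a + b) * x) • (rowTransfer n (freeFermion a b x) true false *
          (q • fermionParity S n - ξ ^ n • 1)) := by
  have exchange := rowTransfer_mul_creation a b x ξ (planeWave (n + 1) ξ) (planeWave_castSucc ξ)
  rw [tail_planeWave, planeWave_zero, planeWave_last] at exchange
  have hA := exchange false false
  have hD := exchange true true
  simp only [Bool.toNat_false, Bool.toNat_true, Bool.not_true, Bool.not_false, Nat.cast_one,
    Nat.cast_zero, pow_zero, pow_one] at hA hD
  simp only [transferMatrix, add_mul, mul_add, mul_sub, smul_mul, Matrix.mul_smul, mul_one]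
  linear_combination (norm := module) hA + q • hD

theorem fermionParity_mulVec {f : (Fin n → Bool) → S} (hf : f ∈ sector S n k) :
    fermionParity S n *ᵥ f = (-1 : S) ^ k • f := by
  ext σ
  by_cases hσ : numOnes σ = k
  · simp [fermionParity, mulVec_diagonal, hσ]
  · simp [fermionParity, mulVec_diagonal, hf σ hσ]

theorem transferMatrix_mulVec_creation_planeWave (q a b x ξ : S) (hξ : ξ ^ n = (-1) ^ k * q)
    {f : (Fin n → Bool) → S} (hf : f ∈ sector S n k) :
    (1 - b * x * ξ) •
        transferMatrix n (freeFermion a b x) q *ᵥ creation (planeWave n ξ) *ᵥ f =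
      (1 + a * x * ξ) •
        creation (planeWave n ξ) *ᵥ transferMatrix n (freeFermion a b x) (-q) *ᵥ f := by
  have boundary : (q • fermionParity S n - ξ ^ n • 1) *ᵥ f = 0 := by
    rw [sub_mulVec, smul_mulVec, smul_mulVec, one_mulVec, fermionParity_mulVec hf, hξ]
    module
  have h := congrArg (· *ᵥ f) (transferMatrix_mul_creation_planeWave (n := n) q a b x ξ)
  simpa only [add_mulVec, smul_mulVec, ← mulVec_mulVec, boundary, mulVec_zero, smul_zero,
    add_zero] using h

/-- The state without letters `1`. -/
def vacuum (S : Type*) [CommRing S] (n : ℕ) : (Fin n → Bool) → S :=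
  Pi.single (fun _ => false) 1

theorem rowTransfer_apply_false (ω : Weights S) (α : Bool) :
    rowTransfer n ω α α (fun _ => false) (fun _ => false) = vertexWeight ω α false α false ^ n := by
  induction n with
  | zero => simp [rowTransfer_zero]
  | succ n ih =>
    have hcons : (fun _ => false : Fin (n + 1) → Bool) = Fin.cons false fun _ => false :=
      (Fin.cons_self_tail _).symm
    have hblock := congrFun₂ (block_rowTransfer (n := n) ω α α false false)
      (fun _ => false) fun _ => false
    rw [hcons]
    refine hblock.trans ?_
    cases α <;> simp [vertexWeight, ih, pow_succ']

theorem numOnes_eq_zero_iff {σ : Fin n → Bool} : numOnes σ = 0 ↔ σ = fun _ => false := by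
  simp [numOnes, funext_iff]

theorem transferMatrix_mulVec_vacuum (ω : Weights S) (q : S) :
    transferMatrix n ω q *ᵥ vacuum S n = (ω.w1 ^ n + q * ω.w4 ^ n) • vacuum S n := by
  ext σ
  rw [vacuum, mulVec_single_one]
  by_cases hσ : σ = fun _ => false
  · simp [transferMatrix, hσ, rowTransfer_apply_false, vertexWeight]
  · have hne : numOnes σ ≠ numOnes fun _ : Fin n => false := by
      rw [numOnes_eq_zero_iff.mpr rfl]
      exact mt numOnes_eq_zero_iff.mp hσ
    simp [transferMatrix, rowTransfer_eq_zero n ω _ _ _ hne, hσ]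

end Boundary

section Fock

variable {S : Type*} [CommRing S] {n k : ℕ}

/-- The Jordan–Wigner map from the exterior algebra of the one-particle space `S ^ n` to
`V^{⊗ n}`: the wedge product `u₁ ∧ ⋯ ∧ u_k` is sent to the state obtained by letting the creation
operators of `u₁, …, u_k` act on the vacuum. -/
def fock (S : Type*) [CommRing S] (n : ℕ) :
    ExteriorAlgebra S (Fin n → S) →ₗ[S] (Fin n → Bool) → S :=
  ((mulVecBilin S S).flip (vacuum S n)).comp
    (ExteriorAlgebra.lift S ⟨creation, creation_mul_self⟩).toLinearMap

theorem fock_one : fock S n 1 = vacuum S n := by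
  simp [fock]

theorem fock_ι_mul (u : Fin n → S) (ω : ExteriorAlgebra S (Fin n → S)) :
    fock S n (ExteriorAlgebra.ι S u * ω) = creation u *ᵥ fock S n ω := by
  simp [fock]

theorem fock_ιMulti_succ (v : Fin (k + 1) → Fin n → S) :
    fock S n (ExteriorAlgebra.ιMulti S (k + 1) v) =
      creation (v 0) *ᵥ fock S n (ExteriorAlgebra.ιMulti S k (Fin.tail v)) := by
  rw [ExteriorAlgebra.ιMulti_succ_apply, fock_ι_mul]
  rfl

theorem creator_mulVec_single {j : Fin n} {τ : Fin n → Bool} (hτ : τ j = false) :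
    creator S j *ᵥ Pi.single τ 1 =
      (-1 : S) ^ onesBefore τ j • Pi.single (Function.update τ j true) 1 := by
  ext σ
  rw [mulVec_single_one]
  simp [creator, hτ, Pi.single_apply]

theorem creation_single (j : Fin n) : creation (Pi.single j 1) = creator S j := by
  simp [creation]

/-- Binary strings as sets of sites: a finset `s` corresponds to the string whose letters `1` are
at the sites in `s`. -/
def occupation : Finset (Fin n) ≃ (Fin n → Bool) where
  toFun s i := decide (i ∈ s)
  invFun σ := {i | σ i}
  left_inv s := by simp
  right_inv σ := by simp

theorem occupation_apply (s : Finset (Fin n)) (i : Fin n) : occupation s i = decide (i ∈ s) := rfl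

theorem numOnes_occupation (s : Finset (Fin n)) : numOnes (occupation s) = s.card := by
  simp [numOnes, occupation_apply, Bool.toNat, Bool.cond_decide]

theorem fock_ιMulti_single {f : Fin k → Fin n} (hf : StrictMono f) :
    fock S n (ExteriorAlgebra.ιMulti S k fun i => Pi.single (f i) 1) =
      Pi.single (occupation (Finset.univ.image f)) 1 := by
  induction k with
  | zero =>
    have hempty : occupation (∅ : Finset (Fin n)) = fun _ => false := rfl
    simp [fock_one, vacuum, hempty]
  | succ k ih =>
    set τ := occupation (Finset.univ.image (Fin.tail f))
    have hτ (i : Fin n) (hi : i ≤ f 0) : τ i = false := by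
      simpa [τ, occupation_apply, Fin.tail] using fun m h =>
        (hi.trans_lt (hf (Fin.succ_pos m))).ne h.symm
    have honesBefore : onesBefore τ (f 0) = 0 := by
      simp +contextual [onesBefore, hτ, le_of_lt]
    have hupdate : Function.update τ (f 0) true = occupation (Finset.univ.image f) := by
      ext i
      by_cases hi : i = f 0
      · simp [hi, occupation_apply]
      · simp [hi, τ, occupation_apply, Fin.tail, Fin.exists_fin_succ, Ne.symm hi]
    have ih := ih (f := Fin.tail f) fun i j hij => hf (Fin.succ_lt_succ_iff.mpr hij)
    rw [fock_ιMulti_succ, creation_single]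
    refine (congrArg _ ih).trans ?_
    rw [creator_mulVec_single (hτ _ le_rfl), honesBefore, hupdate, pow_zero, one_smul]

/-- The standard basis vector `v_σ` of `V_k`, where the letters `1` of `σ` are at the sites
in `s`. -/
def sectorSingle (S : Type*) [CommRing S] (s : Set.powersetCard (Fin n) k) : sector S n k :=
  ⟨Pi.single (occupation s) 1, fun σ hσ =>
    Pi.single_eq_of_ne (fun h => hσ (by rw [h, numOnes_occupation, Set.powersetCard.card_eq s])) 1⟩

theorem linearIndependent_sectorSingle :
    LinearIndependent S (sectorSingle S : Set.powersetCard (Fin n) k → sector S n k) := by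
  refine LinearIndependent.of_comp (sector S n k).subtype ?_
  exact (Pi.linearIndependent_single_one _ S).comp _
    (occupation.injective.comp Subtype.val_injective)

theorem eq_sum_sectorSingle (f : sector S n k) :
    f = ∑ s : Set.powersetCard (Fin n) k, f.1 (occupation s) • sectorSingle S s := by
  ext σ
  obtain ⟨t, rfl⟩ := occupation.surjective σ
  simp only [AddSubmonoidClass.coe_finsetSum, Submodule.coe_smul, sectorSingle, Finset.sum_apply,
    Pi.smul_apply, smul_eq_mul, Pi.single_apply, occupation.injective.eq_iff, mul_ite, mul_one,
    mul_zero]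
  by_cases ht : t.card = k
  · rw [Fintype.sum_eq_single ⟨t, ht⟩ fun s hs => if_neg fun h => hs (Subtype.ext h.symm)]
    simp
  · rw [f.2 _ (by rwa [numOnes_occupation]), Finset.sum_eq_zero]
    exact fun s _ => if_neg fun h => ht (by rw [h, Set.powersetCard.card_eq s])

/-- The standard basis of `V_k`. -/
def sectorBasis (S : Type*) [CommRing S] (n k : ℕ) :
    Module.Basis (Set.powersetCard (Fin n) k) S (sector S n k) :=
  Module.Basis.mk linearIndependent_sectorSingle fun f _ => by
    rw [eq_sum_sectorSingle f]
    exact Submodule.sum_mem _ fun s _ =>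
      Submodule.smul_mem _ _ (Submodule.subset_span (Set.mem_range_self s))

/-- The Jordan–Wigner isomorphism between the `k`-th exterior power of `S ^ n` and `V_k`. -/
def fockSector (S : Type*) [CommRing S] (n k : ℕ) : ⋀[S]^k (Fin n → S) ≃ₗ[S] sector S n k :=
  ((Pi.basisFun S (Fin n)).exteriorPower k).equiv (sectorBasis S n k) (Equiv.refl _)

theorem image_ofFinEmbEquiv_symm (s : Set.powersetCard (Fin n) k) :
    Finset.univ.image (Set.powersetCard.ofFinEmbEquiv.symm s) = (s : Finset (Fin n)) :=
  Finset.image_orderEmbOfFin_univ _ s.prop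

theorem coe_fockSector (ω : ⋀[S]^k (Fin n → S)) :
    (fockSector S n k ω : (Fin n → Bool) → S) = fock S n ω := by
  suffices h : (sector S n k).subtype ∘ₗ (fockSector S n k).toLinearMap =
      fock S n ∘ₗ (⋀[S]^k (Fin n → S)).subtype from LinearMap.congr_fun h ω
  refine ((Pi.basisFun S (Fin n)).exteriorPower k).ext fun s => ?_
  have hsingle := fock_ιMulti_single (S := S) (Set.powersetCard.ofFinEmbEquiv.symm s).strictMono
  have hbasis :
      fockSector S n k ((Pi.basisFun S (Fin n)).exteriorPower k s) = sectorSingle S s := by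
    rw [fockSector, Module.Basis.equiv_apply, sectorBasis, Module.Basis.mk_apply, Equiv.refl_apply]
  rw [image_ofFinEmbEquiv_symm] at hsingle
  calc (fockSector S n k ((Pi.basisFun S (Fin n)).exteriorPower k s) : (Fin n → Bool) → S)
      = Pi.single (occupation (s : Finset (Fin n))) 1 := by rw [hbasis, sectorSingle]
    _ = _ := by
      simpa [exteriorPower.ιMulti_family, Function.comp_def] using hsingle.symm

theorem fock_ιMulti_mem_sector (v : Fin k → Fin n → S) :
    fock S n (ExteriorAlgebra.ιMulti S k v) ∈ sector S n k := by
  rw [← exteriorPower.ιMulti_apply_coe, ← coe_fockSector]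
  exact (fockSector S n k _).2

end Fock

section BetheVector

variable {S : Type*} [CommRing S] {n k : ℕ}

/-- The Bethe vector with Bethe roots `ξ 0, …, ξ (k - 1)`: the state obtained by creating the
corresponding plane waves from the vacuum. -/
def betheVector (n : ℕ) (ξ : Fin k → S) : (Fin n → Bool) → S :=
  fock S n (ExteriorAlgebra.ιMulti S k fun i => planeWave n (ξ i))

theorem betheVector_zero (ξ : Fin 0 → S) : betheVector n ξ = vacuum S n := by
  simp [betheVector, fock_one]

theorem betheVector_succ (ξ : Fin (k + 1) → S) :
    betheVector n ξ = creation (planeWave n (ξ 0)) *ᵥ betheVector n (Fin.tail ξ) :=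
  fock_ιMulti_succ _

theorem betheVector_mem_sector (ξ : Fin k → S) : betheVector n ξ ∈ sector S n k :=
  fock_ιMulti_mem_sector _

theorem smul_transferMatrix_mulVec_betheVector (q a b x : S) (ξ : Fin k → S)
    (hξ : ∀ i, ξ i ^ n + (-1) ^ k * q = 0) :
    (∏ i, (1 - b * x * ξ i)) • transferMatrix n (freeFermion a b x) q *ᵥ betheVector n ξ =
      ((1 + (-1) ^ k * q * (b * x) ^ n) * ∏ i, (1 + a * x * ξ i)) • betheVector n ξ := by
  induction k generalizing q with
  | zero => simp [betheVector_zero, transferMatrix_mulVec_vacuum, freeFermion]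
  | succ k ih =>
    have hhead : ξ 0 ^ n = (-1) ^ k * q := by linear_combination hξ 0
    have htail (i : Fin k) : Fin.tail ξ i ^ n + (-1) ^ k * -q = 0 := by
      simpa [Fin.tail, pow_succ] using hξ i.succ
    have hcreate := transferMatrix_mulVec_creation_planeWave q a b x (ξ 0) hhead
      (betheVector_mem_sector (Fin.tail ξ))
    rw [betheVector_succ, Fin.prod_univ_succ, Fin.prod_univ_succ, mul_comm (1 - _), mul_smul,
      hcreate, smul_comm, ← mulVec_smul]
    have ih := ih (-q) (Fin.tail ξ) htail
    simp only [Fin.tail] at ih ⊢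
    rw [ih, mulVec_smul, smul_smul]
    congr 1
    ring

theorem creation_comp_ringHom {T : Type*} [CommRing T] (f : S →+* T) (u : Fin n → S) :
    creation (f ∘ u) = (creation u).map f := by
  ext σ τ
  simp [creation_eq_sum, Matrix.sum_apply, creator, apply_ite f]

theorem planeWave_comp_ringHom {T : Type*} [CommRing T] (f : S →+* T) (ξ : S) :
    planeWave n (f ξ) = f ∘ planeWave n ξ := by
  ext j
  simp [planeWave]

theorem betheVector_comp_ringHom {T : Type*} [CommRing T] (f : S →+* T) (ξ : Fin k → S) :
    betheVector n (f ∘ ξ) = f ∘ betheVector n ξ := by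
  induction k with
  | zero =>
    ext σ
    simp [betheVector_zero, vacuum, Pi.single_apply, apply_ite f]
  | succ k ih =>
    ext σ
    rw [betheVector_succ, betheVector_succ, Function.comp_apply, Function.comp_apply,
      planeWave_comp_ringHom, creation_comp_ringHom, RingHom.map_mulVec]
    exact congrFun (congrArg _ (ih (Fin.tail ξ))) σ

end BetheVector

section FieldBethe

variable {K : Type*} [Field K] {n k : ℕ}

theorem transferMatrix_mulVec_betheVector (q a b x : K) (ξ : Fin k → K)
    (hξ : ∀ i, ξ i ^ n + (-1) ^ k * q = 0) (hpole : ∀ i, 1 - b * x * ξ i ≠ 0) :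
    transferMatrix n (freeFermion a b x) q *ᵥ betheVector n ξ =
      ((1 + (-1) ^ k * q * x ^ n * b ^ n) * ∏ i, (1 + a * x * ξ i) / (1 - b * x * ξ i)) •
        betheVector n ξ := by
  have hprod : ∏ i, (1 - b * x * ξ i) ≠ 0 := Finset.prod_ne_zero_iff.mpr fun i _ => hpole i
  refine smul_right_injective _ hprod ?_
  dsimp only
  rw [smul_transferMatrix_mulVec_betheVector q a b x ξ hξ, smul_smul, Finset.prod_div_distrib]
  congr 1
  field_simp
  ring

end FieldBethe

section Fourier

variable {S : Type*} [CommRing S] [IsDomain S] {n : ℕ} {ζ α : S}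

theorem sum_range_pow_pow_eq_zero (hζ : IsPrimitiveRoot ζ n) {m : ℕ} (hm : ¬ n ∣ m) :
    ∑ r ∈ Finset.range n, (ζ ^ r) ^ m = 0 := by
  have hne : ζ ^ m - 1 ≠ 0 := sub_ne_zero.mpr (mt (hζ.pow_eq_one_iff_dvd m).mp hm)
  refine (mul_eq_zero.mp ?_).resolve_right hne
  simp_rw [← pow_mul, mul_comm _ m, pow_mul ζ m]
  rw [geom_sum_mul, ← pow_mul, mul_comm, pow_mul, hζ.pow_eq_one, one_pow, sub_self]

theorem sum_pow_smul_planeWave (hζ : IsPrimitiveRoot ζ n) (α : S) (j : Fin n) :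
    ∑ r : Fin n, (ζ ^ (r : ℕ) * α) ^ (j + 1 : ℕ) • planeWave n (ζ ^ (r : ℕ) * α) =
      Pi.single j (n * α ^ n) := by
  ext i
  simp only [planeWave, Finset.sum_apply, Pi.smul_apply, smul_eq_mul, ← pow_add]
  simp only [mul_pow _ α, ← Finset.sum_mul]
  rw [Fin.sum_univ_eq_sum_range fun r => (ζ ^ r) ^ (j + 1 + i.rev : ℕ)]
  obtain rfl | hij := eq_or_ne i j
  · simp [← pow_mul, mul_comm _ n, pow_mul ζ n, hζ.pow_eq_one]
  · have hdvd : ¬ n ∣ (j + 1 + i.rev : ℕ) := fun h => by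
      have := Nat.eq_of_dvd_of_lt_two_mul (by omega) h (by omega)
      rw [Fin.val_rev] at this
      omega
    rw [sum_range_pow_pow_eq_zero hζ hdvd, zero_mul, Pi.single_eq_of_ne hij]

theorem span_planeWave_eq_top (hn : IsUnit (n : S)) (hζ : IsPrimitiveRoot ζ n) (hα : IsUnit α) :
    Submodule.span S (Set.range fun r : Fin n => planeWave n (ζ ^ (r : ℕ) * α)) = ⊤ := by
  obtain ⟨u, hu⟩ := hn.mul (hα.pow n)
  rw [← top_le_iff, ← (Pi.basisFun S (Fin n)).span_eq, Submodule.span_le]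
  rintro _ ⟨j, rfl⟩
  have hsingle : Pi.basisFun S (Fin n) j = (↑u⁻¹ : S) • Pi.single j (n * α ^ n) := by
    rw [← hu, Pi.basisFun_apply, ← Pi.single_smul, smul_eq_mul, Units.inv_mul]
  rw [hsingle, ← sum_pow_smul_planeWave hζ]
  exact Submodule.smul_mem _ _ (Submodule.sum_mem _ fun r _ =>
    Submodule.smul_mem _ _ (Submodule.subset_span (Set.mem_range_self r)))

/-- The Fourier basis of the one-particle space: the plane waves at the `n` solutions `ζ ^ r * α`
of an equation `ξ ^ n = c`. -/
def planeWaveBasis (hn : IsUnit (n : S)) (hζ : IsPrimitiveRoot ζ n) (hα : IsUnit α) :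
    Module.Basis (Fin n) S (Fin n → S) :=
  basisOfTopLeSpanOfCardEqFinrank _ (span_planeWave_eq_top hn hζ hα).ge (by simp)

theorem planeWaveBasis_apply (hn : IsUnit (n : S)) (hζ : IsPrimitiveRoot ζ n) (hα : IsUnit α)
    (r : Fin n) : planeWaveBasis hn hζ hα r = planeWave n (ζ ^ (r : ℕ) * α) := by
  rw [planeWaveBasis, coe_basisOfTopLeSpanOfCardEqFinrank]

end Fourier

section BetheBasis

variable {S : Type*} [CommRing S] {n k : ℕ} {ζ α : S}

theorem injective_pow_mul (hζ : IsPrimitiveRoot ζ n) (hα : IsUnit α) :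
    Function.Injective fun r : Fin n => ζ ^ (r : ℕ) * α := fun i j h =>
  Fin.ext (hζ.pow_inj i.2 j.2 (hα.mul_right_cancel h))

variable [IsDomain S]

/-- The basis of `V_k` formed by the Bethe vectors whose Bethe roots are `k` of the `n` solutions
`ζ ^ r * α` of an equation `ξ ^ n = c`. -/
def betheBasis (hn : IsUnit (n : S)) (hζ : IsPrimitiveRoot ζ n) (hα : IsUnit α) (k : ℕ) :
    Module.Basis (Set.powersetCard (Fin n) k) S (sector S n k) :=
  ((planeWaveBasis hn hζ hα).exteriorPower k).map (fockSector S n k)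

theorem coe_betheBasis (hn : IsUnit (n : S)) (hζ : IsPrimitiveRoot ζ n) (hα : IsUnit α)
    (s : Set.powersetCard (Fin n) k) :
    (betheBasis hn hζ hα k s : (Fin n → Bool) → S) =
      betheVector n fun i => ζ ^ (Set.powersetCard.ofFinEmbEquiv.symm s i : ℕ) * α := by
  rw [betheBasis, Module.Basis.map_apply, coe_fockSector, exteriorPower.basis_apply, betheVector]
  simp [exteriorPower.ιMulti_family, Function.comp_def, planeWaveBasis_apply]

theorem exists_pow_mul_eq (hζ : IsPrimitiveRoot ζ n) (hα : IsUnit α) (hn : n ≠ 0) {ξ : S}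
    (hξ : ξ ^ n = α ^ n) : ∃ r : Fin n, ζ ^ (r : ℕ) * α = ξ := by
  have : NeZero n := ⟨hn⟩
  obtain ⟨u, rfl⟩ := hα
  have hone : (ξ * ↑u⁻¹) ^ n = 1 := by
    rw [mul_pow, hξ, ← mul_pow, Units.mul_inv, one_pow]
  obtain ⟨r, hr, h⟩ := hζ.eq_pow_of_pow_eq_one hone
  exact ⟨⟨r, hr⟩, by simp [h]⟩

/-- The solutions of the Bethe ansatz equations are the sets of `k` of the `n` elements
`ζ ^ r * α`. -/
def betheSolutionEquiv (hζ : IsPrimitiveRoot ζ n) (hn : n ≠ 0) (hα : IsUnit α) {q : S}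
    (hq : α ^ n + (-1) ^ k * q = 0) :
    Set.powersetCard (Fin n) k ≃ BetheSolution S n k q :=
  Equiv.ofBijective
    (fun s => ⟨(s : Finset (Fin n)).map ⟨_, injective_pow_mul hζ hα⟩, by
      refine ⟨by rw [Finset.card_map, Set.powersetCard.card_eq s], fun ξ hξ => ?_⟩
      obtain ⟨r, -, rfl⟩ := Finset.mem_map.mp hξ
      simpa [mul_pow, ← pow_mul, mul_comm _ n, pow_mul ζ n, hζ.pow_eq_one] using hq⟩) <| by
  refine ⟨fun s t h => Subtype.ext (Finset.map_injective _ (congrArg Subtype.val h)), fun t => ?_⟩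
  have hsub : t.1 ⊆ Finset.univ.map ⟨_, injective_pow_mul hζ hα⟩ := fun ξ hξ => by
    obtain ⟨r, rfl⟩ := exists_pow_mul_eq hζ hα hn (add_right_cancel ((t.2.2 ξ hξ).trans hq.symm))
    exact Finset.mem_map_of_mem _ (Finset.mem_univ r)
  obtain ⟨s, -, hs⟩ := Finset.subset_map_iff.mp hsub
  exact ⟨⟨s, by rw [Set.powersetCard.mem_iff, ← t.2.1, hs, Finset.card_map]⟩, Subtype.ext hs.symm⟩

theorem coe_betheSolutionEquiv (hζ : IsPrimitiveRoot ζ n) (hn : n ≠ 0) (hα : IsUnit α) {q : S}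
    (hq : α ^ n + (-1) ^ k * q = 0) (s : Set.powersetCard (Fin n) k) :
    ((betheSolutionEquiv hζ hn hα hq s).1 : Set S) =
      Set.range fun i => ζ ^ (Set.powersetCard.ofFinEmbEquiv.symm s i : ℕ) * α := by
  change (((s : Finset (Fin n)).map ⟨_, injective_pow_mul hζ hα⟩ : Finset S) : Set S) = _
  rw [← image_ofFinEmbEquiv_symm s, Finset.coe_map, Finset.coe_image, Finset.coe_univ,
    Set.image_univ, ← Set.range_comp]
  rfl

end BetheBasis

section Spectral

variable {R : Type*} [CommRing R] {n k : ℕ}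

theorem algebraMap_spectralField_injective :
    Function.Injective (algebraMap R (SpectralField R)) := by
  rw [IsScalarTower.algebraMap_eq R R[X] (SpectralField R)]
  exact (IsFractionRing.injective R[X] _).comp C_injective

theorem one_sub_mul_spectralX_ne_zero [Nontrivial R] (b ξ : R) :
    1 - algebraMap R (SpectralField R) b * spectralX R * algebraMap R (SpectralField R) ξ ≠ 0 := by
  have hpoly : (1 - C b * X * C ξ : R[X]) ≠ 0 := fun h => by simpa using congrArg (eval 0) h
  have hmap := (map_ne_zero_iff _ (IsFractionRing.injective R[X] (SpectralField R))).mpr hpoly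
  simpa [spectralX, IsScalarTower.algebraMap_apply R R[X] (SpectralField R)] using hmap

theorem coe_sectorMap (L : Type*) [CommRing L] [Algebra R L] (v : sector R n k) :
    (sectorMap L v : (Fin n → Bool) → L) = algebraMap R L ∘ v := rfl

variable [IsDomain R]

theorem sectorTransfer_sectorMap_betheVector (q a b : R) {ξ : Fin k → R}
    (hinj : Function.Injective ξ) (hξ : ∀ i, ξ i ^ n + (-1) ^ k * q = 0) {v : sector R n k}
    (hv : (v : (Fin n → Bool) → R) = betheVector n ξ) {s : Finset R}
    (hs : (s : Set R) = Set.range ξ) :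
    sectorTransfer n k (algebraMap R (SpectralField R) q) (algebraMap R (SpectralField R) a)
        (algebraMap R (SpectralField R) b) (spectralX R) (sectorMap (SpectralField R) v) =
      betheEigenvalue n k q a b s • sectorMap (SpectralField R) v := by
  classical
  set ι := algebraMap R (SpectralField R)
  have hmap : (sectorMap (SpectralField R) v : (Fin n → Bool) → SpectralField R) =
      betheVector n (ι ∘ ξ) := by
    rw [betheVector_comp_ringHom, ← hv, coe_sectorMap]
  have hprod (g : R → SpectralField R) : ∏ η ∈ s, g η = ∏ i, g (ξ i) := by
    have himage : s = Finset.univ.image ξ := by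
      rw [← Finset.coe_inj, hs, Finset.coe_image, Finset.coe_univ, Set.image_univ]
    rw [himage, Finset.prod_image hinj.injOn]
  refine Subtype.ext ?_
  rw [Submodule.coe_smul, hmap, betheEigenvalue, hprod]
  refine (congrArg _ hmap).trans (transferMatrix_mulVec_betheVector _ _ _ _ (ι ∘ ξ) (fun i => ?_)
    fun i => one_sub_mul_spectralX_ne_zero b (ξ i))
  simpa using congrArg ι (hξ i)

theorem sectorMap_betheBasis {L : Type*} [CommRing L] [IsDomain L] [Algebra R L]
    {ζ α : R} (hn : IsUnit (n : R)) (hn' : IsUnit (n : L)) (hζ : IsPrimitiveRoot ζ n)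
    (hζ' : IsPrimitiveRoot (algebraMap R L ζ) n) (hα : IsUnit α) (s : Set.powersetCard (Fin n) k) :
    sectorMap L (betheBasis hn hζ hα k s) =
      betheBasis hn' hζ' (hα.map (algebraMap R L)) k s := by
  refine Subtype.ext ?_
  rw [coe_sectorMap, coe_betheBasis, coe_betheBasis, ← betheVector_comp_ringHom]
  simp [Function.comp_def]

theorem sectorTransfer_sectorMap_betheBasis (q a b : R) {ζ α : R} (hn : IsUnit (n : R))
    (hn0 : n ≠ 0) (hζ : IsPrimitiveRoot ζ n) (hα : IsUnit α) (hq : α ^ n + (-1) ^ k * q = 0)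
    (s : Set.powersetCard (Fin n) k) :
    sectorTransfer n k (algebraMap R (SpectralField R) q) (algebraMap R (SpectralField R) a)
        (algebraMap R (SpectralField R) b) (spectralX R)
        (sectorMap (SpectralField R) (betheBasis hn hζ hα k s)) =
      betheEigenvalue n k q a b (betheSolutionEquiv hζ hn0 hα hq s).1 •
        sectorMap (SpectralField R) (betheBasis hn hζ hα k s) := by
  refine sectorTransfer_sectorMap_betheVector q a b
    ((injective_pow_mul hζ hα).comp (Set.powersetCard.ofFinEmbEquiv.symm s).injective)
    (fun i => (betheSolutionEquiv hζ hn0 hα hq s).2.2 _ ?_) (coe_betheBasis hn hζ hα s)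
    (coe_betheSolutionEquiv hζ hn0 hα hq s)
  rw [← Finset.mem_coe, coe_betheSolutionEquiv]
  exact Set.mem_range_self i

end Spectral

theorem hasEigenvalue_iff_exists_of_basis {A M ι : Type*} [CommRing A] [IsDomain A]
    [AddCommGroup M] [Module A M] [Finite ι] (v : Module.Basis ι A M) {T : Module.End A M}
    {d : ι → A} (h : ∀ i, T (v i) = d i • v i) (μ : A) : T.HasEigenvalue μ ↔ ∃ i, μ = d i := by
  classical
  have := Fintype.ofFinite ι
  have := Module.Free.of_basis v
  have hT : T = Matrix.toLin v v (Matrix.diagonal d) :=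
    v.ext fun i => by simp [h, Matrix.toLin_self, Matrix.diagonal_apply]
  rw [hT, hasEigenvalue_toLin_diagonal_iff]
  simp only [eq_comm]

theorem exists_pow_add_mul_eq_zero (F : Type*) {R : Type*} [Field F] [IsAlgClosed F] [CommRing R]
    [Algebra F R] {n : ℕ} (k : ℕ) (hn : n ≠ 0) {q : R} (hq : ∃ p : R, p ^ n = q) :
    ∃ α : R, α ^ n + (-1) ^ k * q = 0 := by
  obtain ⟨p, rfl⟩ := hq
  obtain ⟨z, hz⟩ := IsAlgClosed.exists_pow_nat_eq (-(-1) ^ k : F) (Nat.pos_of_ne_zero hn)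
  refine ⟨algebraMap F R z * p, ?_⟩
  rw [mul_pow, ← map_pow, hz]
  simp

end SixVertex

end

theorem mainTheorem10_general {R : Type*} [CommRing R] [IsDomain R] (n k : ℕ)
    (hn : IsUnit (n : R)) {ζ : R} (hζ : IsPrimitiveRoot ζ n) {q : R} (hq : IsUnit q)
    {α : R} (hα : α ^ n + (-1) ^ k * q = 0) (a b : R) :
    Nat.card (SixVertex.BetheSolution R n k q) = n.choose k ∧
    (∃ v : Module.Basis (SixVertex.BetheSolution R n k q) R (SixVertex.sector R n k),
      ∀ s : SixVertex.BetheSolution R n k q,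
        SixVertex.sectorTransfer n k
            (algebraMap R (SixVertex.SpectralField R) q)
            (algebraMap R (SixVertex.SpectralField R) a)
            (algebraMap R (SixVertex.SpectralField R) b)
            (SixVertex.spectralX R)
            (SixVertex.sectorMap (SixVertex.SpectralField R) (v s)) =
          SixVertex.betheEigenvalue n k q a b s.1 •
            SixVertex.sectorMap (SixVertex.SpectralField R) (v s)) ∧
    (∀ μ : SixVertex.SpectralField R,
      Module.End.HasEigenvalue
          (SixVertex.sectorTransfer n k
            (algebraMap R (SixVertex.SpectralField R) q)
            (algebraMap R (SixVertex.SpectralField R) a)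
            (algebraMap R (SixVertex.SpectralField R) b)
            (SixVertex.spectralX R)) μ ↔
        ∃ s : SixVertex.BetheSolution R n k q,
          μ = SixVertex.betheEigenvalue n k q a b s.1) := by
  have hn0 : n ≠ 0 := by
    rintro rfl
    simp at hn
  have hunit : IsUnit α := by
    rw [← isUnit_pow_iff hn0, eq_neg_of_add_eq_zero_left hα]
    exact ((isUnit_one.neg.pow k).mul hq).neg
  let e := SixVertex.betheSolutionEquiv hζ hn0 hunit hα
  have heigen := SixVertex.sectorTransfer_sectorMap_betheBasis q a b hn hn0 hζ hunit hα
  refine ⟨?_, ⟨(SixVertex.betheBasis hn hζ hunit k).reindex e, e.forall_congr_right.mp fun s => ?_⟩,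
    fun μ => ?_⟩
  · rw [← Nat.card_congr e, Set.powersetCard.card, Nat.card_fin]
  · simpa using heigen s
  · have hn' : IsUnit (n : SixVertex.SpectralField R) := by
      simpa using hn.map (algebraMap R (SixVertex.SpectralField R))
    have hζ' := hζ.map_of_injective SixVertex.algebraMap_spectralField_injective
    rw [← e.exists_congr_right]
    refine SixVertex.hasEigenvalue_iff_exists_of_basis
      (SixVertex.betheBasis hn' hζ' (hunit.map (algebraMap R (SixVertex.SpectralField R))) k)
      (fun s => ?_) μ
    rw [← SixVertex.sectorMap_betheBasis hn]
    exact heigen s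

theorem mainTheorem10 {R : Type*} [CommRing R] [IsDomain R] [Algebra ℂ R]
    (n k : ℕ) (hn : 1 ≤ n) (hk : k ≤ n) (q : R) (hq : IsUnit q) (hroot : ∃ p : R, p ^ n = q)
    (a b : R) :
    -- the Bethe ansatz equations have `n.choose k = dim V_k` solutions
    Nat.card (SixVertex.BetheSolution R n k q) = n.choose k ∧
    -- `τ(x; a, b)` is diagonalisable on `V_k`, by a basis of eigenvectors free of `x`
    (∃ v : Module.Basis (SixVertex.BetheSolution R n k q) R (SixVertex.sector R n k),
      ∀ s : SixVertex.BetheSolution R n k q,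
        SixVertex.sectorTransfer n k
            (algebraMap R (SixVertex.SpectralField R) q)
            (algebraMap R (SixVertex.SpectralField R) a)
            (algebraMap R (SixVertex.SpectralField R) b)
            (SixVertex.spectralX R)
            (SixVertex.sectorMap (SixVertex.SpectralField R) (v s)) =
          SixVertex.betheEigenvalue n k q a b s.1 •
            SixVertex.sectorMap (SixVertex.SpectralField R) (v s)) ∧
    -- the eigenvalues are exactly those given by the solutions of the Bethe ansatz equations
    (∀ μ : SixVertex.SpectralField R,
      Module.End.HasEigenvalue
          (SixVertex.sectorTransfer n k
            (algebraMap R (SixVertex.SpectralField R) q)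
            (algebraMap R (SixVertex.SpectralField R) a)
            (algebraMap R (SixVertex.SpectralField R) b)
            (SixVertex.spectralX R)) μ ↔
        ∃ s : SixVertex.BetheSolution R n k q,
          μ = SixVertex.betheEigenvalue n k q a b s.1) := by
  have hn0 : n ≠ 0 := Nat.one_le_iff_ne_zero.mp hn
  have hunit : IsUnit (n : R) := by
    simpa using (Nat.cast_ne_zero.mpr hn0 : (n : ℂ) ≠ 0).isUnit.map (algebraMap ℂ R)
  have hζ := (Complex.isPrimitiveRoot_exp n hn0).map_of_injective (algebraMap ℂ R).injective
  obtain ⟨α, hα⟩ := SixVertex.exists_pow_add_mul_eq_zero ℂ k hn0 hroot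
  exact mainTheorem10_general n k hunit hζ hq hα a b
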